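/- For a topological space $X$, let $d(X)$ be the smallest cardinality of a dense subset of $X$, and let the pinning down number $pd(X)$ be the smallest cardinal $\kappa$ such that for every neighborhood assignment $U$ on $X$ (a map assigning to each $x\in X$ an open set $U(x)\ni x$) there is a set $A\subseteq X$ of cardinality $\kappa$ with $A\cap U(x)\neq\emptyset$ for all $x\in X$. For a cardinal $\kappa$, let $\kappa^{+0}=\kappa$, let $\kappa^{+(n+1)}$ be the smallest cardinal greater than $\kappa^{+n}$, and let $\kappa^{+\omega}=\sup_{n<\omega}\kappa^{+n}$. A space is called $0$-dimensional if its clopen subsets form a base of its topology. Then the following three statements are equivalent: 1. $2^\kappa<\kappa^{+\omega}$ for every cardinal $\kappa$; 2. $d(X)=pd(X)$ for every Hausdorff space $X$; 3. $d(X)=pd(X)$ for every $0$-dimensional Hausdorff space $X$. -/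

import Mathlib

open Cardinal Topology

universe u

noncomputable section

/-- The `ω`-th cardinal successor `κ^{+ω} = sup_n κ^{+n}`. -/
def succOmega (κ : Cardinal.{u}) : Cardinal.{u} :=
  ⨆ n : ℕ, Order.succ^[n] κ

/-- The density `d(X)`: the least cardinality of a dense subset of `X`. -/
def topDensity (X : Type u) [TopologicalSpace X] : Cardinal.{u} :=
  sInf {κ | ∃ D : Set X, Dense D ∧ #D = κ}

/-- `U` is a neighborhood assignment on `X`: every `U x` is an open set containing `x`. -/
def IsNhdAssignment {X : Type u} [TopologicalSpace X] (U : X → Set X) : Prop :=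
  ∀ x, IsOpen (U x) ∧ x ∈ U x

/-- `A` pins down `U`: it meets every `U x`. -/
def PinsDown {X : Type u} (A : Set X) (U : X → Set X) : Prop :=
  ∀ x, (A ∩ U x).Nonempty

/-- The pinning down number `pd(X)`: the least cardinal `κ` such that every neighborhood assignment
on `X` is pinned down by a set of size `κ`. -/
def pinningDownNumber (X : Type u) [TopologicalSpace X] : Cardinal.{u} :=
  sInf {κ | ∀ U : X → Set X, IsNhdAssignment U → ∃ A : Set X, #A = κ ∧ PinsDown A U}

/-- `X` is `0`-dimensional: the clopen sets form a base of its topology. -/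
def IsZeroDimensional (X : Type u) [TopologicalSpace X] : Prop :=
  TopologicalSpace.IsTopologicalBasis {s : Set X | IsClopen s}

end

/-!
Suppose `2 ^ κ < κ^{+ω}` for all `κ`. Up to a nowhere dense remainder, a Hausdorff space is a
disjoint union of open subspaces `Y` that are neat: all their nonempty open subsets have size `#Y`.
In a neat space any `#Y` nonempty open sets have an injective choice of points, so a single
neighborhood assignment takes all of them as values and some set of size `κ = pd(Y)` meets each one.
Applied to the intersections of the members of a separating family of open sets, this gives
`#Y ≤ 2 ^ 2 ^ κ < κ^{+ω}`. If `d(Y) > κ`, then `#Y = κ^{+n}` for some `n`, so `#Y` sets of size `κ`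
are cofinal among all such sets. The complements of their closures are nonempty, but a set of size
`κ` meeting all of them cannot be contained in a member of the cofinal family.

Conversely, let `κ^{+ω} ≤ 2 ^ κ`. Then `I = ∏ n, κ^{+(n+1)}` has size at most `2 ^ κ`, so the Cantor
cube over `I` has a dense subset `E` of size `κ`. Truncate every `x ∈ E` to the coordinates `g ∈ I`
with `g n ≤ a`, for all `n` and all `a < κ^{+(n+1)}`. By regularity of the `κ^{+(n+1)}`, for any `κ`
truncated points some `g` exceeds all their bounds, and they all vanish there. Yet for a given
neighborhood assignment one bound `b n < κ^{+(n+2)}` is enough to handle all points truncated at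
level `n`, so `κ` points pin it down.
-/

universe v

section Cardinals

theorem lt_succOmega_iff {κ μ : Cardinal.{u}} : μ < succOmega κ ↔ ∃ n : ℕ, μ < Order.succ^[n] κ :=
  lt_ciSup_iff' bddAbove_of_small

theorem succ_iterate_le_succOmega (κ : Cardinal.{u}) (n : ℕ) : Order.succ^[n] κ ≤ succOmega κ :=
  le_ciSup (f := fun n : ℕ => Order.succ^[n] κ) bddAbove_of_small n

theorem succOmega_succ_iterate_le (κ : Cardinal.{u}) (n : ℕ) :
    succOmega (Order.succ^[n] κ) ≤ succOmega κ :=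
  ciSup_le' fun m => by
    rw [← Function.iterate_add_apply]
    exact succ_iterate_le_succOmega κ (m + n)

theorem natCast_le_succ_iterate (κ : Cardinal.{u}) (n : ℕ) : (n : Cardinal) ≤ Order.succ^[n] κ := by
  induction n with
  | zero => simp
  | succ n ih =>
    rw [Function.iterate_succ_apply', Nat.cast_succ]
    exact add_one_le_of_lt (Order.lt_succ_of_le ih)

theorem aleph0_le_succOmega (κ : Cardinal.{u}) : ℵ₀ ≤ succOmega κ :=
  aleph0_le.2 fun n => (natCast_le_succ_iterate κ n).trans (succ_iterate_le_succOmega κ n)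

theorem two_power_two_power_lt_succOmega (h : ∀ κ : Cardinal.{u}, 2 ^ κ < succOmega κ)
    (κ : Cardinal.{u}) : 2 ^ (2 : Cardinal) ^ κ < succOmega κ := by
  obtain ⟨n, hn⟩ := lt_succOmega_iff.1 (h κ)
  calc 2 ^ (2 : Cardinal) ^ κ ≤ 2 ^ Order.succ^[n] κ := power_le_power_left two_ne_zero hn.le
    _ < succOmega (Order.succ^[n] κ) := h _
    _ ≤ succOmega κ := succOmega_succ_iterate_le κ n

theorem exists_eq_succ_iterate {α : Type*} [LinearOrder α] [SuccOrder α] {a b : α} {n : ℕ}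
    (hab : a ≤ b) (hb : b ≤ Order.succ^[n] a) : ∃ m : ℕ, b = Order.succ^[m] a := by
  induction n with
  | zero => exact ⟨0, hb.antisymm hab⟩
  | succ n ih =>
    rcases le_or_gt b (Order.succ^[n] a) with h | h
    · exact ih h
    · refine ⟨n + 1, hb.antisymm ?_⟩
      rw [Function.iterate_succ_apply']
      exact Order.succ_le_of_lt h

theorem exists_forall_lt_of_mk_le {μ : Cardinal.{u}} (hμ : ℵ₀ ≤ μ)
    {s : Set (Order.succ μ).ord.ToType} (hs : #s ≤ μ) : ∃ b, ∀ a ∈ s, a < b :=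
  not_isCofinal_iff.1 fun hcof => (Order.lt_succ μ).not_ge <| by
    calc Order.succ μ = Order.cof (Order.succ μ).ord.ToType := by
          rw [Ordinal.cof_toType, (isRegular_succ hμ).cof_ord]
      _ ≤ #s := Order.cof_le hcof
      _ ≤ μ := hs

theorem exists_forall_mem_finset_lt {μ : Cardinal.{u}} (hμ : ℵ₀ ≤ μ) {P β : Type u} (hP : #P ≤ μ)
    (T : P → Finset β) (f : β → (Order.succ μ).ord.ToType) : ∃ b, ∀ p, ∀ t ∈ T p, f t < b := by
  have hle : #(⋃ p, f '' (T p : Set β)) ≤ μ :=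
    calc #(⋃ p, f '' (T p : Set β)) ≤ sum fun p => #(f '' (T p : Set β)) := mk_iUnion_le_sum_mk
      _ ≤ sum fun _ : P => ℵ₀ := sum_le_sum _ _ fun p => ((T p).finite_toSet.image f).lt_aleph0.le
      _ = #P * ℵ₀ := sum_const' _ _
      _ ≤ μ := mul_le_of_le hμ hP hμ
  obtain ⟨b, hb⟩ := exists_forall_lt_of_mk_le hμ hle
  exact ⟨b, fun p t ht => hb _ (Set.mem_iUnion.2 ⟨p, t, ht, rfl⟩)⟩

theorem exists_injective_forall_mem {ι X : Type u} {V : ι → Set X} (hV : ∀ i, #ι ≤ #(V i)) :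
    ∃ x : ι → X, Function.Injective x ∧ ∀ i, x i ∈ V i := by
  obtain ⟨_, _, hord⟩ := exists_ord_eq_type_lt ι
  have exists_fresh (i : ι) (f : Set.Iio i → X) : ∃ z ∈ V i, ∀ j, f j ≠ z := by
    by_contra! hz
    have hsub : V i ⊆ Set.range f := fun z hzV => hz z hzV
    exact (mk_Iio_lt i hord).not_ge (((hV i).trans (mk_le_mk_of_subset hsub)).trans mk_range_le)
  choose! fresh fresh_mem fresh_ne using exists_fresh
  let x : ι → X := wellFounded_lt.fix fun i f => fresh i fun j => f j.1 j.2
  have hx (i : ι) : x i = fresh i fun j => x j.1 := wellFounded_lt.fix_eq _ i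
  have hne (i j : ι) (hji : j < i) : x j ≠ x i := by
    rw [hx i]
    exact fresh_ne i (fun j => x j.1) ⟨j, hji⟩
  refine ⟨x, fun i j hij => ?_, fun i => hx i ▸ fresh_mem _ _⟩
  by_contra hij'
  rcases lt_or_gt_of_ne hij' with h | h
  exacts [hne j i h hij, hne i j h hij.symm]

theorem exists_superset_mk_eq {X : Type u} {A : Set X} {κ : Cardinal.{u}} (hA : #A ≤ κ)
    (hX : κ ≤ #X) : ∃ B, A ⊆ B ∧ #B = κ := by
  rcases lt_or_ge κ ℵ₀ with hκ | hκ
  · obtain ⟨n, rfl⟩ := lt_aleph0.1 hκ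
    obtain ⟨B, hAB, -, hB⟩ := Set.exists_superset_subset_encard_eq (k := n) (Set.subset_univ A)
      (by simpa using OrderHomClass.mono toENat hA)
      (by simpa only [map_natCast, Set.toENat_cardinalMk] using
        OrderHomClass.mono toENat (hX.trans_eq mk_univ.symm))
    exact ⟨B, hAB, toENat_eq_natCast.1 hB⟩
  · obtain ⟨C, hC⟩ := le_mk_iff_exists_set.1 hX
    refine ⟨A ∪ C, Set.subset_union_left, le_antisymm ?_ ?_⟩
    · exact (mk_union_le A C).trans (add_le_of_le hκ hA hC.le)
    · exact hC.ge.trans (mk_le_mk_of_subset Set.subset_union_right)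

theorem mk_le_two_power_two_power_of_separates {X : Type u} {B : Set (Set X)} {A : Set X}
    (hB : ∀ x y, x ≠ y → ∃ u ∈ B, ∃ v ∈ B, x ∈ u ∧ y ∈ v ∧ Disjoint u v)
    (hA : ∀ u ∈ B, ∀ v ∈ B, (u ∩ v).Nonempty → (A ∩ (u ∩ v)).Nonempty) :
    #X ≤ 2 ^ (2 : Cardinal) ^ #A := by
  let traces (x : X) : Set (Set A) := {s | ∃ u ∈ B, x ∈ u ∧ Subtype.val ⁻¹' u = s}
  have htraces : Function.Injective traces := fun x y hxy => by
    by_contra hne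
    obtain ⟨u, hu, v, hv, hxu, hyv, hd⟩ := hB x y hne
    obtain ⟨w, hw, hyw, hwu⟩ : Subtype.val ⁻¹' u ∈ traces y := hxy ▸ ⟨u, hu, hxu, rfl⟩
    obtain ⟨a, haA, haw, hav⟩ := hA w hw v hv ⟨y, hyw, hyv⟩
    have hau : (⟨a, haA⟩ : A) ∈ Subtype.val ⁻¹' u := hwu ▸ haw
    exact Set.disjoint_left.1 hd hau hav
  simpa only [mk_set] using mk_le_of_injective htraces

end Cardinals

section CoveringNumber

variable {α : Type u} {κ μ : Cardinal.{u}}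

/-- The covering number `cf([α]^{≤κ}, ⊆)`: the least size of a family of subsets of `α` of size at
most `κ` such that every subset of `α` of size at most `κ` is contained in a member. -/
noncomputable def coveringNumber (α : Type u) (κ : Cardinal.{u}) : Cardinal.{u} :=
  Order.cof {A : Set α // #A ≤ κ}

theorem coveringNumber_le {ι : Type u} {F : ι → Set α} (hF : ∀ i, #(F i) ≤ κ)
    (hcov : ∀ A : Set α, #A ≤ κ → ∃ i, A ⊆ F i) : coveringNumber α κ ≤ #ι :=
  (Order.cof_le (s := Set.range fun i => (⟨F i, hF i⟩ : {A : Set α // #A ≤ κ})) fun A =>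
    let ⟨i, hi⟩ := hcov A.1 A.2
    ⟨_, ⟨i, rfl⟩, hi⟩).trans mk_range_le

theorem exists_mk_eq_coveringNumber (α : Type u) (κ : Cardinal.{u}) :
    ∃ (ι : Type u) (F : ι → Set α), #ι = coveringNumber α κ ∧ (∀ i, #(F i) ≤ κ) ∧
      ∀ A : Set α, #A ≤ κ → ∃ i, A ⊆ F i := by
  obtain ⟨s, hs, hcard⟩ := Order.exists_cof_eq {A : Set α // #A ≤ κ}
  refine ⟨s, fun i => i.1.1, hcard, fun i => i.1.2, fun A hA => ?_⟩
  obtain ⟨B, hB, hAB⟩ := hs ⟨A, hA⟩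
  exact ⟨⟨B, hB⟩, hAB⟩

theorem coveringNumber_le_one (hα : #α ≤ κ) : coveringNumber α κ ≤ 1 :=
  (coveringNumber_le (ι := PUnit) (F := fun _ => Set.univ) (fun _ => mk_univ.trans_le hα)
    fun _ _ => ⟨⟨⟩, Set.subset_univ _⟩).trans_eq mk_punit

theorem coveringNumber_le_succ (hμ : ℵ₀ ≤ μ) (hα : #α ≤ Order.succ μ) :
    coveringNumber α μ ≤ Order.succ μ := by
  rw [← mk_ord_toType (Order.succ μ)] at hα ⊢
  obtain ⟨j⟩ := hα
  refine coveringNumber_le (F := fun b => j ⁻¹' Set.Iio b) (fun b => ?_) fun A hA => ?_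
  · have hb : #(Set.Iio b) < Order.succ μ := by simpa using mk_Iio_lt b (by simp)
    exact (mk_preimage_of_injective _ _ j.injective).trans (Order.lt_succ_iff.1 hb)
  · obtain ⟨b, hb⟩ := exists_forall_lt_of_mk_le hμ (mk_image_le (f := j).trans hA)
    exact ⟨b, fun a ha => hb _ (Set.mem_image_of_mem j ha)⟩

theorem coveringNumber_le_mul {ν : Cardinal.{u}} (hκμ : κ ≤ μ)
    (hν : ∀ S : Set α, #S ≤ μ → coveringNumber S κ ≤ ν) :
    coveringNumber α κ ≤ coveringNumber α μ * ν := by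
  obtain ⟨ι, S, hι, hS, hcovS⟩ := exists_mk_eq_coveringNumber α μ
  choose ι' F hι' hF hcovF using fun i => exists_mk_eq_coveringNumber (S i) κ
  have hle : coveringNumber α κ ≤ #(Σ i, ι' i) :=
    coveringNumber_le (F := fun p => Subtype.val '' F p.1 p.2)
      (fun p => mk_image_le.trans (hF p.1 p.2)) fun A hA => by
        obtain ⟨i, hAi⟩ := hcovS A (hA.trans hκμ)
        obtain ⟨k, hk⟩ := hcovF i (Subtype.val ⁻¹' A)
          ((mk_preimage_of_injective _ _ Subtype.val_injective).trans hA)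
        exact ⟨⟨i, k⟩, fun a ha => ⟨⟨a, hAi ha⟩, hk ha, rfl⟩⟩
  calc coveringNumber α κ ≤ #(Σ i, ι' i) := hle
    _ = sum fun i => #(ι' i) := mk_sigma _
    _ ≤ sum fun _ : ι => ν := sum_le_sum _ _ fun i => (hι' i).trans_le (hν _ (hS i))
    _ = coveringNumber α μ * ν := by rw [sum_const', hι]

theorem coveringNumber_le_succ_iterate (hκ : ℵ₀ ≤ κ) (n : ℕ) (hα : #α ≤ Order.succ^[n] κ) :
    coveringNumber α κ ≤ Order.succ^[n] κ := by
  induction n generalizing α with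
  | zero => exact (coveringNumber_le_one hα).trans (one_le_aleph0.trans hκ)
  | succ n ih =>
    rw [Function.iterate_succ_apply'] at hα ⊢
    have hκμ : κ ≤ Order.succ^[n] κ := Order.le_succ_iterate n κ
    have hμ : ℵ₀ ≤ Order.succ^[n] κ := hκ.trans hκμ
    exact (coveringNumber_le_mul hκμ fun S hS => ih hS).trans
      (mul_le_of_le (hμ.trans (Order.le_succ _)) (coveringNumber_le_succ hμ hα) (Order.le_succ _))

end CoveringNumber

section DensityAndPinning

variable {X : Type u} [TopologicalSpace X]

theorem topDensity_le {D : Set X} (hD : Dense D) : topDensity X ≤ #D :=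
  csInf_le' (show #D ∈ {κ | ∃ D : Set X, Dense D ∧ #D = κ} from ⟨D, hD, rfl⟩)

variable (X) in
theorem topDensity_le_mk : topDensity X ≤ #X :=
  (topDensity_le dense_univ).trans_eq mk_univ

variable (X) in
theorem exists_dense_mk_eq_topDensity : ∃ D : Set X, Dense D ∧ #D = topDensity X :=
  csInf_mem (s := {κ | ∃ D : Set X, Dense D ∧ #D = κ}) ⟨_, Set.univ, dense_univ, rfl⟩

theorem topDensity_le_sum_of_dense_iUnion {ι : Type u} {Y : ι → Set X} (hY : Dense (⋃ i, Y i)) :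
    topDensity X ≤ sum fun i => topDensity (Y i) := by
  choose D hD hDcard using fun i => exists_dense_mk_eq_topDensity (Y i)
  have hdense : Dense (⋃ i, Subtype.val '' D i) := by
    refine dense_closure.1 (hY.mono (Set.iUnion_subset fun i => ?_))
    exact (Subtype.dense_iff.1 (hD i)).trans
      (closure_mono (Set.subset_iUnion (fun i => Subtype.val '' D i) i))
  calc topDensity X ≤ #(⋃ i, Subtype.val '' D i) := topDensity_le hdense
    _ ≤ sum fun i => #(Subtype.val '' D i) := mk_iUnion_le_sum_mk
    _ ≤ sum fun i => topDensity (Y i) := sum_le_sum _ _ fun i => mk_image_le.trans_eq (hDcard i)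

theorem exists_pinsDown_mk_eq_pinningDownNumber {U : X → Set X} (hU : IsNhdAssignment U) :
    ∃ A : Set X, #A = pinningDownNumber X ∧ PinsDown A U :=
  csInf_mem (s := {κ | ∀ U : X → Set X, IsNhdAssignment U → ∃ A : Set X, #A = κ ∧ PinsDown A U})
    ⟨#X, fun _ hU => ⟨Set.univ, mk_univ, fun x => ⟨x, trivial, (hU x).2⟩⟩⟩ U hU

theorem pinningDownNumber_le {κ : Cardinal.{u}}
    (h : ∀ U : X → Set X, IsNhdAssignment U → ∃ A : Set X, #A ≤ κ ∧ PinsDown A U) :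
    pinningDownNumber X ≤ κ := by
  rcases le_total κ #X with hX | hX
  · refine csInf_le' fun U hU => ?_
    obtain ⟨A, hA, hAU⟩ := h U hU
    obtain ⟨B, hAB, hB⟩ := exists_superset_mk_eq hA hX
    exact ⟨B, hB, fun x => (hAU x).mono (Set.inter_subset_inter_left _ hAB)⟩
  · refine (csInf_le' fun U hU => ?_).trans hX
    exact ⟨Set.univ, mk_univ, fun x => ⟨x, trivial, (hU x).2⟩⟩

variable (X) in
theorem pinningDownNumber_le_topDensity : pinningDownNumber X ≤ topDensity X := by
  obtain ⟨D, hD, hDcard⟩ := exists_dense_mk_eq_topDensity X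
  exact pinningDownNumber_le fun U hU =>
    ⟨D, hDcard.le, fun x => hD.exists_mem_open (hU x).1 ⟨x, (hU x).2⟩⟩

theorem exists_mk_le_pinningDownNumber_of_injective {ι : Type*} {x : ι → X}
    (hx : Function.Injective x) {V : ι → Set X} (hV : ∀ i, IsOpen (V i)) (hxV : ∀ i, x i ∈ V i) :
    ∃ A : Set X, #A ≤ pinningDownNumber X ∧ ∀ i, (A ∩ V i).Nonempty := by
  let U : X → Set X := Function.extend x V fun _ => Set.univ
  have hUx (i : ι) : U (x i) = V i := hx.extend_apply _ _ _
  have hU : IsNhdAssignment U := fun z => by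
    by_cases hz : ∃ i, x i = z
    · obtain ⟨i, rfl⟩ := hz
      exact (hUx i).symm ▸ ⟨hV i, hxV i⟩
    · simp [U, Function.extend_apply' _ _ _ hz]
  obtain ⟨A, hA, hAU⟩ := exists_pinsDown_mk_eq_pinningDownNumber hU
  exact ⟨A, hA.le, fun i => hUx i ▸ hAU (x i)⟩

theorem exists_mk_le_pinningDownNumber_of_mk_le {ι : Type u} {V : ι → Set X}
    (hV : ∀ i, IsOpen (V i)) (hι : ∀ i, #ι ≤ #(V i)) :
    ∃ A : Set X, #A ≤ pinningDownNumber X ∧ ∀ i, (A ∩ V i).Nonempty :=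
  let ⟨_, hx, hxV⟩ := exists_injective_forall_mem hι
  exists_mk_le_pinningDownNumber_of_injective hx hV hxV

theorem pinningDownNumber_le_of_isOpen {Y : Set X} (hY : IsOpen Y) :
    pinningDownNumber Y ≤ pinningDownNumber X :=
  pinningDownNumber_le fun U hU => by
    obtain ⟨A, hA, hAU⟩ := exists_mk_le_pinningDownNumber_of_injective Subtype.val_injective
      (fun y => hY.isOpenMap_subtype_val _ (hU y).1) (fun y => Set.mem_image_of_mem _ (hU y).2)
    refine ⟨Subtype.val ⁻¹' A, (mk_preimage_of_injective _ _ Subtype.val_injective).trans hA,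
      fun y => ?_⟩
    obtain ⟨_, haA, a, ha, rfl⟩ := hAU y
    exact ⟨a, haA, ha⟩

theorem lift_mk_le_pinningDownNumber_of_pairwise_disjoint {ι : Type v} {V : ι → Set X}
    (hV : ∀ i, IsOpen (V i)) (hne : ∀ i, (V i).Nonempty)
    (hd : Pairwise (Function.onFun Disjoint V)) :
    lift.{u} #ι ≤ lift.{v} (pinningDownNumber X) := by
  have eq_of_mem {i j : ι} {z : X} (hi : z ∈ V i) (hj : z ∈ V j) : i = j :=
    hd.eq (Set.not_disjoint_iff.2 ⟨z, hi, hj⟩)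
  choose x hxV using hne
  have hx : Function.Injective x := fun i j hij => eq_of_mem (hxV i) (hij ▸ hxV j)
  obtain ⟨A, hA, hAV⟩ := exists_mk_le_pinningDownNumber_of_injective hx hV hxV
  choose a haA haV using hAV
  have ha : Function.Injective fun i => (⟨a i, haA i⟩ : A) := fun i j hij =>
    have haij : a i = a j := congrArg Subtype.val hij
    eq_of_mem (haV i) (haij ▸ haV j)
  exact (lift_mk_le_lift_mk_of_injective ha).trans (lift_le.2 hA)

theorem mk_le_pinningDownNumber_of_discreteTopology [DiscreteTopology X] :
    #X ≤ pinningDownNumber X := by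
  simpa using lift_mk_le_pinningDownNumber_of_pairwise_disjoint (X := X) (V := fun x => {x})
    (fun x => isOpen_discrete _) (fun x => Set.singleton_nonempty x)
    fun x y hxy => Set.disjoint_singleton.2 hxy

theorem aleph0_le_pinningDownNumber [T2Space X] [Infinite X] : ℵ₀ ≤ pinningDownNumber X := by
  obtain ⟨V, hVinf, hV, hd⟩ := exists_seq_infinite_isOpen_pairwise_disjoint X
  simpa using lift_mk_le_pinningDownNumber_of_pairwise_disjoint hV
    (fun n => (hVinf n).nonempty) hd

end DensityAndPinning

section Neat

variable {X : Type u} [TopologicalSpace X]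

variable (X) in
/-- A space is neat if all its nonempty open subsets have the same size as the whole space, i.e. if
its dispersion character is `#X`. Every space contains a dense union of disjoint neat open
subspaces, so that density and pinning down number need only be compared on neat spaces. -/
def IsNeat : Prop :=
  ∀ V : Set X, IsOpen V → V.Nonempty → #X ≤ #V

theorem exists_isNeat_subset {V : Set X} (hV : IsOpen V) (hne : V.Nonempty) :
    ∃ Y ⊆ V, IsOpen Y ∧ Y.Nonempty ∧ IsNeat Y := by
  obtain ⟨Y, ⟨hYV, hY, hYne⟩, hmin⟩ := (InvImage.wf (fun Y : Set X => #Y) Cardinal.lt_wf).has_min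
    {Y : Set X | Y ⊆ V ∧ IsOpen Y ∧ Y.Nonempty} ⟨V, subset_rfl, hV, hne⟩
  refine ⟨Y, hYV, hY, hYne, fun W hW hWne => ?_⟩
  rw [← mk_image_eq (s := W) Subtype.val_injective]
  exact not_lt.1 <| hmin (Subtype.val '' W)
    ⟨(Subtype.coe_image_subset Y W).trans hYV, hY.isOpenMap_subtype_val W hW, hWne.image _⟩

theorem exists_pairwiseDisjoint_dense_sUnion {P : Set X → Prop}
    (hP : ∀ V, IsOpen V → V.Nonempty → ∃ Y ⊆ V, IsOpen Y ∧ Y.Nonempty ∧ P Y) :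
    ∃ c : Set (Set X), (∀ Y ∈ c, IsOpen Y ∧ Y.Nonempty ∧ P Y) ∧ c.PairwiseDisjoint id ∧
      Dense (⋃₀ c) := by
  obtain ⟨c, ⟨hcP, hcd⟩, hmax⟩ := zorn_subset
    {c : Set (Set X) | (∀ Y ∈ c, IsOpen Y ∧ Y.Nonempty ∧ P Y) ∧ c.PairwiseDisjoint id}
    fun C hC hchain => ⟨⋃₀ C, ⟨fun Y ⟨c, hcC, hYc⟩ => (hC hcC).1 Y hYc,
      (Set.pairwiseDisjoint_sUnion hchain.directedOn).2 fun c hcC => (hC hcC).2⟩,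
      fun c => Set.subset_sUnion_of_mem⟩
  refine ⟨c, hcP, hcd, dense_iff_inter_open.2 fun V hV hVne => ?_⟩
  obtain ⟨Z, hZV, hZ⟩ := hP V hV hVne
  by_contra hdis
  have hZc : ∀ Y ∈ c, Disjoint Z Y := fun Y hY => Set.disjoint_left.2 fun z hzZ hzY =>
    hdis ⟨z, hZV hzZ, Y, hY, hzY⟩
  have hmem : Z ∈ c := hmax ⟨Set.forall_mem_insert.2 ⟨hZ, hcP⟩, hcd.insert fun Y hY _ => hZc Y hY⟩
    (Set.subset_insert Z c) (Set.mem_insert Z c)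
  exact hZ.2.1.ne_empty (disjoint_self.1 (hZc Z hmem))

/-- The neat pieces of `X` form a cellular family, so there are at most `pd(X)` of them. -/
theorem topDensity_le_pinningDownNumber_of_isNeat (hpd : ℵ₀ ≤ pinningDownNumber X)
    (h : ∀ Y : Set X, IsNeat Y → topDensity Y ≤ pinningDownNumber Y) :
    topDensity X ≤ pinningDownNumber X := by
  obtain ⟨c, hc, hcd, hdense⟩ :=
    exists_pairwiseDisjoint_dense_sUnion (X := X)
      (P := fun Y => IsNeat Y) fun _ hV => exists_isNeat_subset hV
  rw [Set.sUnion_eq_iUnion] at hdense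
  have hcard : #c ≤ pinningDownNumber X := by
    simpa using lift_mk_le_pinningDownNumber_of_pairwise_disjoint (fun Y : c => (hc Y Y.2).1)
      (fun Y : c => (hc Y Y.2).2.1) hcd.subtype
  calc topDensity X ≤ sum fun Y : c => topDensity Y := topDensity_le_sum_of_dense_iUnion hdense
    _ ≤ sum fun _ : c => pinningDownNumber X := sum_le_sum _ _ fun Y =>
        (h Y (hc Y Y.2).2.2).trans (pinningDownNumber_le_of_isOpen (hc Y Y.2).1)
    _ = #c * pinningDownNumber X := sum_const' _ _
    _ ≤ pinningDownNumber X := mul_le_of_le hpd hcard le_rfl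

theorem exists_separating_family_mk_le [T2Space X] [Infinite X] :
    ∃ B : Set (Set X), #B ≤ #X ∧ (∀ u ∈ B, IsOpen u) ∧
      ∀ x y, x ≠ y → ∃ u ∈ B, ∃ v ∈ B, x ∈ u ∧ y ∈ v ∧ Disjoint u v := by
  choose u v hu hv hxu hyv hd using fun p : {p : X × X // p.1 ≠ p.2} => t2_separation p.2
  have hX : ℵ₀ ≤ #X := aleph0_le_mk X
  have hpairs : #{p : X × X // p.1 ≠ p.2} ≤ #X :=
    (mk_subtype_le _).trans (by rw [← mul_def, mul_eq_self hX])
  refine ⟨Set.range u ∪ Set.range v, ?_, ?_, fun x y hxy => ?_⟩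
  · exact (mk_union_le _ _).trans
      (add_le_of_le hX (mk_range_le.trans hpairs) (mk_range_le.trans hpairs))
  · rintro _ (⟨p, rfl⟩ | ⟨p, rfl⟩)
    exacts [hu p, hv p]
  · exact ⟨_, .inl ⟨⟨(x, y), hxy⟩, rfl⟩, _, .inr ⟨⟨(x, y), hxy⟩, rfl⟩, hxu _, hyv _, hd _⟩

theorem IsNeat.mk_le_two_power_two_power [T2Space X] [Infinite X] (hX : IsNeat X) :
    #X ≤ 2 ^ (2 : Cardinal) ^ pinningDownNumber X := by
  obtain ⟨B, hBcard, hBo, hB⟩ := exists_separating_family_mk_le (X := X)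
  have hpairs : #{p : B × B // (p.1.1 ∩ p.2.1).Nonempty} ≤ #X :=
    calc #{p : B × B // (p.1.1 ∩ p.2.1).Nonempty} ≤ #(B × B) := mk_subtype_le _
      _ = #B * #B := (mul_def _ _).symm
      _ ≤ #X := mul_le_of_le (aleph0_le_mk X) hBcard hBcard
  obtain ⟨A, hA, hAB⟩ := exists_mk_le_pinningDownNumber_of_mk_le
    (V := fun p : {p : B × B // (p.1.1 ∩ p.2.1).Nonempty} => p.1.1.1 ∩ p.1.2.1)
    (fun p => (hBo _ p.1.1.2).inter (hBo _ p.1.2.2))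
    (fun p => hpairs.trans (hX _ ((hBo _ p.1.1.2).inter (hBo _ p.1.2.2)) p.2))
  calc #X ≤ 2 ^ (2 : Cardinal) ^ #A := mk_le_two_power_two_power_of_separates hB
        fun u hu v hv huv => hAB ⟨(⟨u, hu⟩, ⟨v, hv⟩), huv⟩
    _ ≤ 2 ^ (2 : Cardinal) ^ pinningDownNumber X :=
        power_le_power_left two_ne_zero (power_le_power_left two_ne_zero hA)

theorem IsNeat.topDensity_le_pinningDownNumber (hX : IsNeat X) (hpd : ℵ₀ ≤ pinningDownNumber X)
    (hlt : #X < succOmega (pinningDownNumber X)) : topDensity X ≤ pinningDownNumber X := by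
  by_contra! hd
  obtain ⟨n, hn⟩ := lt_succOmega_iff.1 hlt
  obtain ⟨m, hm⟩ := exists_eq_succ_iterate (hd.le.trans (topDensity_le_mk X)) hn.le
  obtain ⟨ι, F, hι, hF, hcov⟩ := exists_mk_eq_coveringNumber X (pinningDownNumber X)
  have hιX : #ι ≤ #X := hι.trans_le (hm ▸ coveringNumber_le_succ_iterate hpd m hm.le)
  have hFne (i : ι) : (closure (F i))ᶜ.Nonempty := Set.nonempty_compl.2 fun hcl =>
    hd.not_ge ((topDensity_le (dense_iff_closure_eq.2 hcl)).trans (hF i))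
  obtain ⟨A, hA, hAF⟩ := exists_mk_le_pinningDownNumber_of_mk_le
    (fun i => isClosed_closure.isOpen_compl)
    (fun i => hιX.trans (hX _ isClosed_closure.isOpen_compl (hFne i)))
  obtain ⟨i, hAi⟩ := hcov A hA
  obtain ⟨a, haA, haF⟩ := hAF i
  exact haF (subset_closure (hAi haA))

theorem topDensity_eq_pinningDownNumber_of_two_power_lt
    (h : ∀ κ : Cardinal.{u}, 2 ^ κ < succOmega κ) (X : Type u) [TopologicalSpace X] [T2Space X] :
    topDensity X = pinningDownNumber X := by
  have of_finite (Y : Type u) [TopologicalSpace Y] [T2Space Y] [Finite Y] :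
      topDensity Y ≤ pinningDownNumber Y :=
    (topDensity_le_mk Y).trans mk_le_pinningDownNumber_of_discreteTopology
  refine le_antisymm ?_ (pinningDownNumber_le_topDensity X)
  cases finite_or_infinite X
  · exact of_finite X
  · refine topDensity_le_pinningDownNumber_of_isNeat aleph0_le_pinningDownNumber fun Y hY => ?_
    cases finite_or_infinite Y
    · exact of_finite Y
    · exact hY.topDensity_le_pinningDownNumber aleph0_le_pinningDownNumber
        (hY.mk_le_two_power_two_power.trans_lt (two_power_two_power_lt_succOmega h _))

end Neat

section CantorCube

theorem IsZeroDimensional.of_isInducing {X Y : Type*} [TopologicalSpace X] [TopologicalSpace Y]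
    {f : X → Y} (hf : IsInducing f) (hY : IsZeroDimensional Y) : IsZeroDimensional X := by
  refine TopologicalSpace.isTopologicalBasis_of_isOpen_of_nhds (fun s hs => hs.isOpen)
    fun x V hxV hV => ?_
  obtain ⟨W, hW, rfl⟩ := hf.isOpen_iff.1 hV
  obtain ⟨C, hC, hxC, hCW⟩ := hY.exists_subset_of_mem_open hxV hW
  exact ⟨f ⁻¹' C, hC.preimage hf.continuous, hxC, Set.preimage_mono hCW⟩

theorem isZeroDimensional_subtype_pi_bool {I : Type*} (S : Set (I → Bool)) : IsZeroDimensional S :=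
  .of_isInducing IsInducing.subtypeVal isTopologicalBasis_isClopen

theorem exists_finset_forall_eq_imp_mem {X I : Type*} {π : I → Type*} [TopologicalSpace X]
    [∀ i, TopologicalSpace (π i)] {f : X → ∀ i, π i} (hf : IsInducing f) {U : Set X}
    (hU : IsOpen U) {x : X} (hx : x ∈ U) :
    ∃ T : Finset I, ∀ y, (∀ i ∈ T, f y i = f x i) → y ∈ U := by
  obtain ⟨W, hW, rfl⟩ := hf.isOpen_iff.1 hU
  obtain ⟨T, u, hu, hTW⟩ := isOpen_pi_iff.1 hW (f x) hx
  exact ⟨T, fun y hy => hTW fun i hi => (hy i hi).symm ▸ (hu i hi).2⟩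

theorem dense_pi_iff_forall_finset {I : Type*} {π : I → Type*} [∀ i, TopologicalSpace (π i)]
    [∀ i, DiscreteTopology (π i)] {E : Set (∀ i, π i)} :
    Dense E ↔ ∀ (x : ∀ i, π i) (T : Finset I), ∃ y ∈ E, ∀ i ∈ T, y i = x i := by
  refine ⟨fun hE x T => ?_, fun hE => dense_iff_inter_open.2 fun U hU ⟨x, hx⟩ => ?_⟩
  · obtain ⟨y, hyE, hy⟩ := hE.exists_mem_open
      (isOpen_set_pi T.finite_toSet fun i _ => isOpen_discrete {x i}) ⟨x, fun i _ => rfl⟩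
    exact ⟨y, hyE, hy⟩
  · obtain ⟨T, hT⟩ := exists_finset_forall_eq_imp_mem .id hU hx
    obtain ⟨y, hyE, hy⟩ := hE x T
    exact ⟨y, hT y hy, hyE⟩

theorem exists_finset_forall_mem_iff_imp_eq {K : Type*} (T : Finset (Set K)) :
    ∃ F : Finset K, ∀ s ∈ T, ∀ t ∈ T, (∀ a ∈ F, a ∈ s ↔ a ∈ t) → s = t := by
  classical
  have hsep (s t : Set K) : ∃ F : Finset K, (∀ a ∈ F, a ∈ s ↔ a ∈ t) → s = t := by
    by_cases hst : s = t
    · exact ⟨∅, fun _ => hst⟩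
    · obtain ⟨a, ha⟩ := not_forall.1 fun h => hst (Set.ext h)
      exact ⟨{a}, fun h => absurd (h a (Finset.mem_singleton_self a)) ha⟩
  choose F hF using hsep
  refine ⟨(T ×ˢ T).biUnion fun p => F p.1 p.2, fun s hs t ht h => hF s t fun a ha => h a ?_⟩
  exact Finset.mem_biUnion.2 ⟨(s, t), Finset.mk_mem_product hs ht, ha⟩

/-- The Hewitt–Marczewski–Pondiczery theorem for the Cantor cube. Identifying `I` with a family of
subsets of a set `K` of size `κ`, the dense set consists of the functions `s ↦ [s ∩ F ∈ t]` with
`F` a finite subset of `K` and `t` a finite set of finite subsets of `K`. -/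
theorem topDensity_pi_bool_le {I : Type u} {κ : Cardinal.{u}} (hκ : ℵ₀ ≤ κ) (hI : #I ≤ 2 ^ κ) :
    topDensity (I → Bool) ≤ κ := by
  classical
  induction κ using Cardinal.inductionOn with | _ K
  rw [← mk_set] at hI
  obtain ⟨e⟩ := hI
  have : Infinite K := infinite_iff.2 hκ
  let point (q : Finset K × Finset (Finset K)) : I → Bool := fun i => {a ∈ q.1 | a ∈ e i} ∈ q.2
  have hdense : Dense (Set.range point) := dense_pi_iff_forall_finset.2 fun x T => by
    obtain ⟨F, hF⟩ := exists_finset_forall_mem_iff_imp_eq (T.map e)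
    refine ⟨_, ⟨(F, {i ∈ T | x i}.image fun i => {a ∈ F | a ∈ e i}), rfl⟩, fun i hi => ?_⟩
    have htrace {j : I} (hj : j ∈ T) (h : {a ∈ F | a ∈ e j} = {a ∈ F | a ∈ e i}) : j = i :=
      e.injective <| hF _ (Finset.mem_map_of_mem e hj) _ (Finset.mem_map_of_mem e hi)
        (Finset.filter_inj'.1 h)
    rw [Bool.eq_iff_iff]
    simp only [point, decide_eq_true_eq, Finset.mem_image, Finset.mem_filter]
    exact ⟨fun ⟨j, ⟨hj, hxj⟩, h⟩ => htrace hj h ▸ hxj, fun hxi => ⟨i, ⟨hi, hxi⟩, rfl⟩⟩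
  calc topDensity (I → Bool) ≤ #(Set.range point) := topDensity_le hdense
    _ ≤ #(Finset K × Finset (Finset K)) := mk_range_le
    _ = #K := by simp [mul_eq_self hκ]

end CantorCube

section Truncation

variable {L : ℕ → Type*} [∀ n, LinearOrder (L n)]

/-- The point of the Cantor cube over `∏ n, L n` obtained from `x` by switching off every
coordinate `g` with `a < g n`. -/
def truncate (n : ℕ) (a : L n) (x : (∀ n, L n) → Bool) : (∀ n, L n) → Bool :=
  fun g => x g && decide (g n ≤ a)

theorem truncate_apply_of_le {n : ℕ} {a : L n} {g : ∀ n, L n} (h : g n ≤ a)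
    (x : (∀ n, L n) → Bool) : truncate n a x g = x g := by
  simp [truncate, h]

theorem le_of_truncate_apply {n : ℕ} {a : L n} {x : (∀ n, L n) → Bool} {g : ∀ n, L n}
    (h : truncate n a x g = true) : g n ≤ a := by
  simp_all [truncate]

/-- The subspace of the Cantor cube formed by all truncations of the points of `E`. For a small
dense set `E` and suitable `L` it has a small pinning down number but no small dense set. -/
def truncations (E : Set ((∀ n, L n) → Bool)) : Set ((∀ n, L n) → Bool) :=
  {y | ∃ n a, ∃ x ∈ E, truncate n a x = y}

end Truncation

section Counterexample

variable {κ : Cardinal.{u}}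

variable (κ) in
/-- A well-ordered set whose order type is the cardinal `κ^{+(n+1)}`. -/
abbrev Level (n : ℕ) : Type u :=
  (Order.succ (Order.succ^[n] κ)).ord.ToType

instance (n : ℕ) : Nonempty (Level κ n) :=
  mk_ne_zero_iff.1 <| by simp

theorem mk_level (n : ℕ) : #(Level κ n) = Order.succ^[n + 1] κ := by
  rw [mk_ord_toType, Function.iterate_succ_apply']

theorem mk_pi_level_le (hκ : ℵ₀ ≤ κ) (h : succOmega κ ≤ 2 ^ κ) : #(∀ n, Level κ n) ≤ 2 ^ κ :=
  calc #(∀ n, Level κ n) = prod fun n => #(Level κ n) := mk_pi _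
    _ ≤ prod fun _ : ℕ => 2 ^ κ := prod_le_prod _ _ fun n =>
        (mk_level n).trans_le ((succ_iterate_le_succOmega κ _).trans h)
    _ = 2 ^ κ := by simp [← power_mul, mul_aleph0_eq hκ]

theorem lt_topDensity_truncations (hκ : ℵ₀ ≤ κ) {E : Set ((∀ n, Level κ n) → Bool)}
    (hE : Dense E) : κ < topDensity (truncations E) := by
  by_contra! hle
  obtain ⟨D, hD, hDcard⟩ := exists_dense_mk_eq_topDensity (truncations E)
  have hbd (y : truncations E) : ∃ a : ∀ n, Level κ n, ∀ g, y.1 g = true → ∃ n, g n ≤ a n := by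
    obtain ⟨_, n, a, x, -, rfl⟩ := y
    refine ⟨Function.update (fun _ => Classical.arbitrary _) n a, fun g hg => ⟨n, ?_⟩⟩
    simpa using le_of_truncate_apply hg
  choose a ha using hbd
  choose g hg using fun n => exists_forall_lt_of_mk_le (hκ.trans (Order.le_succ_iterate n κ))
    (s := (fun y => a y n) '' D)
    (mk_image_le.trans ((hDcard.trans_le hle).trans (Order.le_succ_iterate n κ)))
  obtain ⟨x, hxE, hx⟩ := dense_pi_iff_forall_finset.1 hE (fun _ => true) {g}
  have hyg : truncate 0 (g 0) x g = true := by simp [truncate, hx]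
  have hcont : Continuous fun y : truncations E => y.1 g :=
    (continuous_apply (A := fun _ => Bool) g).comp continuous_subtype_val
  obtain ⟨y, hyD, hy⟩ := hD.exists_mem_open
    ((isOpen_discrete {true}).preimage hcont) ⟨⟨_, 0, g 0, x, hxE, rfl⟩, hyg⟩
  obtain ⟨n, hn⟩ := ha y g hy
  exact (hg n _ ⟨y, hyD, rfl⟩).not_ge hn

/-- The points truncated at level `n` number at most `κ^{+(n+1)}`, so a single `b n` in level
`n + 1` dominates all coordinates on which their neighborhoods depend. Truncating the points of `E`
at `b n` therefore leaves these coordinates unchanged. -/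
theorem pinningDownNumber_truncations_le (hκ : ℵ₀ ≤ κ) {E : Set ((∀ n, Level κ n) → Bool)}
    (hE : Dense E) (hEκ : #E ≤ κ) : pinningDownNumber (truncations E) ≤ κ := by
  refine pinningDownNumber_le fun U hU => ?_
  choose T hT using fun y => exists_finset_forall_eq_imp_mem IsInducing.subtypeVal (hU y).1 (hU y).2
  let point (n : ℕ) (a : Level κ n) (x : E) : truncations E := ⟨truncate n a x, n, a, x, x.2, rfl⟩
  have hlevel (n : ℕ) : #(Level κ n × E) ≤ Order.succ^[n + 1] κ := by
    rw [← mul_def, mk_level]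
    have hκn : κ ≤ Order.succ^[n + 1] κ := Order.le_succ_iterate _ κ
    exact mul_le_of_le (hκ.trans hκn) le_rfl (hEκ.trans hκn)
  choose b hb using fun n => exists_forall_mem_finset_lt
    (hκ.trans (Order.le_succ_iterate (n + 1) κ)) (hlevel n) (fun p => T (point n p.1 p.2))
    fun g : ∀ n, Level κ n => g (n + 1)
  refine ⟨Set.range fun q : ULift.{u} ℕ × E => point (q.1.down + 1) (b q.1.down) q.2, ?_, ?_⟩
  · calc _ ≤ #(ULift.{u} ℕ × E) := mk_range_le
      _ = ℵ₀ * #E := by simp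
      _ ≤ κ := mul_le_of_le hκ hκ hEκ
  · rintro ⟨_, n, a, x, hxE, rfl⟩
    obtain ⟨x', hx'E, hx'⟩ :=
      dense_pi_iff_forall_finset.1 hE (truncate n a x) (T (point n a ⟨x, hxE⟩))
    refine ⟨_, ⟨(⟨n⟩, ⟨x', hx'E⟩), rfl⟩, hT _ _ fun g hg => ?_⟩
    exact (truncate_apply_of_le (hb n (a, ⟨x, hxE⟩) g hg).le x').trans (hx' g hg)

theorem exists_pinningDownNumber_lt_topDensity (h : succOmega κ ≤ 2 ^ κ) :
    ∃ (X : Type u) (_ : TopologicalSpace X), T2Space X ∧ IsZeroDimensional X ∧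
      pinningDownNumber X < topDensity X := by
  have hκ : ℵ₀ ≤ κ := not_lt.1 fun hfin =>
    (power_lt_aleph0 (natCast_lt_aleph0 (n := 2)) hfin).not_ge ((aleph0_le_succOmega κ).trans h)
  obtain ⟨E, hE, hEcard⟩ := exists_dense_mk_eq_topDensity ((∀ n, Level κ n) → Bool)
  have hEκ : #E ≤ κ := hEcard.trans_le (topDensity_pi_bool_le hκ (mk_pi_level_le hκ h))
  exact ⟨truncations E, inferInstance, inferInstance, isZeroDimensional_subtype_pi_bool _,
    (pinningDownNumber_truncations_le hκ hE hEκ).trans_lt (lt_topDensity_truncations hκ hE)⟩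

end Counterexample

theorem theorem1 :
    List.TFAE [
      ∀ κ : Cardinal.{u}, 2 ^ κ < succOmega κ,
      ∀ (X : Type u) [TopologicalSpace X] [T2Space X],
        topDensity X = pinningDownNumber X,
      ∀ (X : Type u) [TopologicalSpace X] [T2Space X], IsZeroDimensional X →
        topDensity X = pinningDownNumber X] := by
  tfae_have 1 → 2 := topDensity_eq_pinningDownNumber_of_two_power_lt
  tfae_have 2 → 3 := fun h X _ _ _ => h X
  tfae_have 3 → 1 := fun h κ => by
    by_contra! hκ
    obtain ⟨X, _, _, hX, hlt⟩ := exists_pinningDownNumber_lt_topDensity hκ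
    exact hlt.ne' (h X hX)
  tfae_finish
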